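/- Let $(X,d,\mu)$ be a complete metric measure space, $\mu$ a Borel measure with $0<\mu(B)<\infty$ for every open ball $B$. All curves are non-constant, compact and rectifiable, and are parametrized by arc length, $\gamma:[0,\ell]\to X$; $\int_{\gamma|_{[s,t]}}\rho\,ds=\int_s^t\rho(\gamma(r))\,dr$. For a family $\Gamma$ of curves, $\operatorname{Mod}_1(\Gamma)=\inf\int_X\rho\,d\mu$ over Borel $\rho:X\to[0,\infty]$ with $\int_\gamma\rho\,ds\ge1$ for all $\gamma\in\Gamma$, and $\operatorname{AM}(\Gamma)=\inf\liminf_i\int_X\rho_i\,d\mu$ over sequences of Borel $\rho_i:X\to[0,\infty]$ with $\liminf_i\int_\gamma\rho_i\,ds\ge1$ for all $\gamma\in\Gamma$. A Borel function $g:X\to[0,\infty]$ is a $1$-weak upper gradient of $v$ if $|v(\gamma(0))-v(\gamma(\ell))|\le\int_\gamma g\,ds$ for all curves $\gamma$ outside a family with $\operatorname{Mod}_1=0$. For $u\in L^1_{\rm loc}(X)$ let $$\|Du\|(X)=\inf\Big\{\liminf_{i\to\infty}\ \inf_{g}\int_X g\,d\mu\ :\ v_i\ \text{locally Lipschitz},\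 v_i\to u\text{ in }L^1_{\rm loc}(X)\Big\},$$ where the inner infimum is over all $1$-weak upper gradients $g$ of $v_i$. Let $\operatorname{BV}(X)$ be the class of $u\in L^1(X)$ with $\|Du\|(X)<\infty$, with norm $\|u\|_{\operatorname{BV}}=\|u\|_{L^1(X)}+\|Du\|(X)$. A sequence $(g_i)$ of non-negative Borel functions in $L^1(X)$ with $\liminf_i\int_Xg_i\,d\mu<\infty$ is a $\operatorname{BV}_{\operatorname{AM}}$-upper bound of $u$ if there is a family $\Gamma$ with $\operatorname{AM}(\Gamma)=0$ such that for every curve $\gamma\notin\Gamma$ there is a set $E\subset[0,\ell]$ of length zero with $$|u(\gamma(t))-u(\gamma(s))|\le\liminf_{i\to\infty}\int_{\gamma|_{[s,t]}}g_i\,ds\qquad\text{for all }s,t\in[0,\ell]\setminus E,\ s<t.$$ Let $\|D_{\operatorname{AM}}u\|(X)$ be the infimum of $\liminf_i\int_Xg_i\,d\mu$ over all $\operatorname{BV}_{\operatorname{AM}}$-upper bounds $(g_i)$ of $u$, and let $\operatorname{BV}_{\operatorname{AM}}(X)$ be the class of $u\in L^1(X)$ having a $\operatorname{BV}_{\operatorname{AM}}$-upper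 bound, with norm $\|u\|_{\operatorname{BV}_{\operatorname{AM}}}=\|u\|_{L^1(X)}+\|D_{\operatorname{AM}}u\|(X)$. Suppose that $\mu$ is doubling, $\mu(2B)\le C_D\,\mu(B)$ for every ball $B$, and that $X$ supports an $\operatorname{AM}$-Poincaré inequality: there are $C_P>0$ and $\lambda\ge1$ such that for every $u\in L^1_{\rm loc}(X)$, every $\operatorname{BV}_{\operatorname{AM}}$-upper bound $(g_i)$ of $u$ and every ball $B$ of radius $r>0$, $$\frac1{\mu(B)}\int_B|u-u_B|\,d\mu\le C_P\,r\,\liminf_{i\to\infty}\frac1{\mu(\lambda B)}\int_{\lambda B}g_i\,d\mu,\qquad u_B=\frac1{\mu(B)}\int_Bu\,d\mu.$$ Then $\operatorname{BV}_{\operatorname{AM}}(X)=\operatorname{BV}(X)$, with comparable norms: there is a constant $C\ge1$, depending only on $C_D$, $C_P$ and $\lambda$, such that for every $u\in L^1(X)$ $$C^{-1}\|Du\|(X)\le\|D_{\operatorname{AM}}u\|(X)\le C\,\|Du\|(X),\qquad C^{-1}\|u\|_{\operatorname{BV}}\le\|u\|_{\operatorname{BV}_{\operatorname{AM}}}\le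 C\,\|u\|_{\operatorname{BV}}.$$ -/

import Mathlib

open MeasureTheory Set Filter Topology
open scoped ENNReal NNReal

noncomputable section

/-- A non-constant compact rectifiable curve in `X`, given by its arc-length parametrization
`[0, length] → X`, `0 < length` (the values of `toFun` outside `[0, length]` play no role).
All path integrals below are taken with respect to arc length, so the curves of the theory are
represented by their arc-length parametrizations. -/
structure RectCurve (X : Type*) [MetricSpace X] where
  length : ℝ
  length_pos : 0 < length
  toFun : ℝ → X
  unitSpeed : HasUnitSpeedOn toFun (Icc 0 length)

namespace RectCurve

variable {X : Type*} [MetricSpace X]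

/-- The path integral `∫_{γ|[s,t]} ρ ds` over the subcurve `γ|[s,t]`. -/
def integralOn (γ : RectCurve X) (s t : ℝ) (ρ : X → ℝ≥0∞) : ℝ≥0∞ :=
  ∫⁻ r in Icc s t, ρ (γ.toFun r)

/-- The path integral `∫_γ ρ ds`. -/
def integral (γ : RectCurve X) (ρ : X → ℝ≥0∞) : ℝ≥0∞ :=
  γ.integralOn 0 γ.length ρ

end RectCurve

section Definitions

variable {X : Type*} [MetricSpace X] [MeasurableSpace X]

/-- The `1`-modulus of a family of curves: the infimum of `∫ ρ dμ` over Borel `ρ : X → [0, ∞]` with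
`∫_γ ρ ds ≥ 1` for all `γ ∈ Γ`. -/
def modOne (μ : Measure X) (Γ : Set (RectCurve X)) : ℝ≥0∞ :=
  ⨅ (ρ : X → ℝ≥0∞) (_ : Measurable ρ) (_ : ∀ γ ∈ Γ, 1 ≤ γ.integral ρ), ∫⁻ x, ρ x ∂μ

/-- The approximate modulus (`AM`-modulus) of a family of curves: the infimum of
`liminf_i ∫ ρ_i dμ` over sequences of Borel `ρ_i : X → [0, ∞]` with
`liminf_i ∫_γ ρ_i ds ≥ 1` for all `γ ∈ Γ`. -/
def modAM (μ : Measure X) (Γ : Set (RectCurve X)) : ℝ≥0∞ :=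
  ⨅ (ρ : ℕ → X → ℝ≥0∞) (_ : ∀ i, Measurable (ρ i))
    (_ : ∀ γ ∈ Γ, 1 ≤ liminf (fun i => γ.integral (ρ i)) atTop),
    liminf (fun i => ∫⁻ x, ρ i x ∂μ) atTop

/-- `g` is a `1`-weak upper gradient of `u`: `g` is a non-negative Borel function and
`|u(γ(a)) - u(γ(b))| ≤ ∫_γ g ds` for `1`-a.e. curve `γ`. -/
def IsWeakUpperGradient (μ : Measure X) (u : X → ℝ) (g : X → ℝ≥0∞) : Prop :=
  Measurable g ∧
    modOne μ {γ : RectCurve X |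
      ¬ ENNReal.ofReal |u (γ.toFun 0) - u (γ.toFun γ.length)| ≤ γ.integral g} = 0

/-- `v_i → u` in `L¹_loc(X)`: convergence in `L¹(B)` for every ball `B`. -/
def TendstoL1Loc (μ : Measure X) (v : ℕ → X → ℝ) (u : X → ℝ) : Prop :=
  ∀ (x : X) (r : ℝ), Tendsto (fun i => ∫⁻ y in Metric.ball x r, ‖v i y - u y‖ₑ ∂μ) atTop (𝓝 0)

/-- Miranda's total variation `‖Du‖(X)`: the infimum, over sequences of locally Lipschitz functions
`v_i → u` in `L¹_loc(X)`, of `liminf_i inf_g ∫ g dμ`, where `g` runs over the `1`-weak upper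
gradients of `v_i`. -/
def totalVar (μ : Measure X) (u : X → ℝ) : ℝ≥0∞ :=
  ⨅ (v : ℕ → X → ℝ) (_ : ∀ i, LocallyLipschitz (v i)) (_ : TendstoL1Loc μ v u),
    liminf (fun i => ⨅ (g : X → ℝ≥0∞) (_ : IsWeakUpperGradient μ (v i) g), ∫⁻ x, g x ∂μ) atTop

/-- `u` is (locally integrable and) of bounded variation. -/
def MemBV (μ : Measure X) (u : X → ℝ) : Prop :=
  LocallyIntegrable u μ ∧ totalVar μ u < ∞

/-- `(g_i)` is a `BV_AM`-upper bound of `u`: the `g_i` are non-negative Borel functions in `L¹(X)`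
with `liminf_i ∫ g_i dμ < ∞`, and outside a family `Γ` of curves with `AM(Γ) = 0`, every curve `γ`
satisfies `|u(γ(t)) - u(γ(s))| ≤ liminf_i ∫_{γ|[s,t]} g_i ds` for all `s < t` outside a subset of
the parameter interval of length zero. -/
def IsBVAMUpperBound (μ : Measure X) (u : X → ℝ) (g : ℕ → X → ℝ≥0∞) : Prop :=
  (∀ i, Measurable (g i)) ∧ (∀ i, ∫⁻ x, g i x ∂μ < ∞) ∧
  liminf (fun i => ∫⁻ x, g i x ∂μ) atTop < ∞ ∧
  ∃ Γ : Set (RectCurve X), modAM μ Γ = 0 ∧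
    ∀ γ : RectCurve X, γ ∉ Γ →
      ∃ E : Set ℝ, volume E = 0 ∧
        ∀ s ∈ Icc 0 γ.length \ E, ∀ t ∈ Icc 0 γ.length \ E, s < t →
          ENNReal.ofReal |u (γ.toFun t) - u (γ.toFun s)| ≤
            liminf (fun i => γ.integralOn s t (g i)) atTop

/-- `u ∈ BV_AM(X)`. -/
def MemBVAM (μ : Measure X) (u : X → ℝ) : Prop :=
  Integrable u μ ∧ ∃ g : ℕ → X → ℝ≥0∞, IsBVAMUpperBound μ u g

/-- `‖D_AM u‖(X)`, the infimum of `liminf_i ∫ g_i dμ` over all `BV_AM`-upper bounds of `u`. -/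
def totalVarAM (μ : Measure X) (u : X → ℝ) : ℝ≥0∞ :=
  ⨅ (g : ℕ → X → ℝ≥0∞) (_ : IsBVAMUpperBound μ u g), liminf (fun i => ∫⁻ x, g i x ∂μ) atTop

/-- The norm `‖u‖_{L¹(X)} + ‖Du‖(X)`. -/
def normBV (μ : Measure X) (u : X → ℝ) : ℝ≥0∞ :=
  (∫⁻ x, ‖u x‖ₑ ∂μ) + totalVar μ u

/-- The norm `‖u‖_{L¹(X)} + ‖D_AM u‖(X)`. -/
def normBVAM (μ : Measure X) (u : X → ℝ) : ℝ≥0∞ :=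
  (∫⁻ x, ‖u x‖ₑ ∂μ) + totalVarAM μ u

/-- `μ` is a doubling measure with constant `CD`: balls have positive and finite measure, and
`μ(2B) ≤ CD μ(B)` for every ball `B`. -/
def IsDoublingWith (μ : Measure X) (CD : ℝ≥0) : Prop :=
  ∀ (x : X) (r : ℝ), 0 < r →
    0 < μ (Metric.ball x r) ∧ μ (Metric.ball x r) < ∞ ∧
      μ (Metric.ball x (2 * r)) ≤ CD * μ (Metric.ball x r)

/-- The `AM`-Poincaré inequality with constants `CP` and `lam`, for balls `B = B(x, r)`:
`⨍_B |u - u_B| dμ ≤ CP rad(B) liminf_i ⨍_{lam B} g_i dμ` for every `BV_AM`-upper bound `(g_i)`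
of `u`. The measurable function `u` is taken to be locally integrable, so that its averages are
defined (in a complete doubling space, locally integrable functions are integrable on balls). -/
def AMPoincareWith (μ : Measure X) (CP : ℝ≥0) (lam : ℝ) : Prop :=
  ∀ (u : X → ℝ) (g : ℕ → X → ℝ≥0∞), LocallyIntegrable u μ → IsBVAMUpperBound μ u g →
    ∀ (x : X) (r : ℝ), 0 < r →
      ⨍⁻ y in Metric.ball x r, ‖u y - ⨍ z in Metric.ball x r, u z ∂μ‖ₑ ∂μ ≤
        CP * ENNReal.ofReal r *
          liminf (fun i => ⨍⁻ y in Metric.ball x (lam * r), g i y ∂μ) atTop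

end Definitions

end

/-!
That `‖D_AM u‖ ≤ ‖Du‖` is a form of Fuglede's lemma: if locally Lipschitz `v_i → u` a.e. and `g_i`
is a `1`-weak upper gradient of `v_i`, then along `1`-a.e. curve, hence along `AM`-a.e. curve,
`v_i → u` at a.e. parameter, and `(g_i)` is a `BV_AM`-upper bound of `u`.

Conversely, let `v` be the discrete convolution of `u` at scale `δ`: a Lipschitz partition of
unity, subordinate to balls around a `δ`-net, averages the means of `u` over the balls of the net.
Near a net point `a` its Lipschitz constant is at most a constant times `δ⁻¹` times the mean
oscillation of `u` on `B(a, 5δ)`. The sum over the net of these oscillations, weighted by measure,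
is by the Poincaré inequality and the bounded overlap of the dilated balls at most a constant
times `δ · liminf_i ∫ g_i dμ`, for any `BV_AM`-upper bound `(g_i)` of `u`. So the `L¹`-distance of
`v` to `u` is `O(δ)`, while `v` has an upper gradient with integral at most a constant times
`liminf_i ∫ g_i dμ`.
-/

noncomputable section

namespace RectCurve

variable {X : Type*} [MetricSpace X]

theorem lipschitzOnWith (γ : RectCurve X) : LipschitzOnWith 1 γ.toFun (Icc 0 γ.length) := by
  intro s hs t ht
  wlog hst : s ≤ t generalizing s t
  · simpa only [edist_comm] using this ht hs (le_of_not_ge hst)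
  calc edist (γ.toFun s) (γ.toFun t) ≤ eVariationOn γ.toFun (Icc 0 γ.length ∩ Icc s t) :=
        eVariationOn.edist_le _ ⟨hs, le_rfl, hst⟩ ⟨ht, hst, le_rfl⟩
    _ = (1 : ℝ≥0) * edist s t := by
        rw [γ.unitSpeed hs ht, edist_comm, edist_dist, Real.dist_eq,
          abs_of_nonneg (sub_nonneg.2 hst), NNReal.coe_one, one_mul, ENNReal.coe_one, one_mul]

theorem continuousOn (γ : RectCurve X) : ContinuousOn γ.toFun (Icc 0 γ.length) :=
  γ.lipschitzOnWith.continuousOn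

theorem aemeasurable [MeasurableSpace X] [BorelSpace X] (γ : RectCurve X) :
    AEMeasurable γ.toFun (volume.restrict (Icc 0 γ.length)) :=
  γ.continuousOn.aemeasurable measurableSet_Icc

/-- The subcurve `γ|[s,t]`, parametrized by arc length. -/
def subcurve (γ : RectCurve X) (s t : ℝ) (hs : 0 ≤ s) (hst : s < t) (ht : t ≤ γ.length) :
    RectCurve X where
  length := t - s
  length_pos := sub_pos.2 hst
  toFun r := γ.toFun (s + r)
  unitSpeed x hx y hy := by
    have hmono : MonotoneOn (s + ·) (Icc x y) := (add_right_mono (a := s)).monotoneOn _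
    have hγ := γ.unitSpeed (x := s + x) ⟨by linarith [hx.1], by linarith [hx.2]⟩
      (y := s + y) ⟨by linarith [hy.1], by linarith [hy.2]⟩
    rw [inter_eq_right.2 (Icc_subset_Icc (by linarith [hx.1]) (by linarith [hy.2])),
      add_sub_add_left_eq_sub] at hγ
    rw [inter_eq_right.2 (Icc_subset_Icc hx.1 hy.2), ← hγ, ← image_const_add_Icc]
    exact eVariationOn.comp_eq_of_monotoneOn γ.toFun _ hmono

theorem integral_subcurve (γ : RectCurve X) {s t : ℝ} (hs : 0 ≤ s) (hst : s < t)
    (ht : t ≤ γ.length) (ρ : X → ℝ≥0∞) :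
    (γ.subcurve s t hs hst ht).integral ρ = γ.integralOn s t ρ := by
  have h := (measurePreserving_add_left volume s).setLIntegral_comp_preimage_emb
    (measurableEmbedding_addLeft s) (fun r => ρ (γ.toFun r)) (Icc s t)
  rwa [preimage_const_add_Icc, sub_self] at h

theorem integralOn_le_integral (γ : RectCurve X) {s t : ℝ} (hs : 0 ≤ s) (ht : t ≤ γ.length)
    (ρ : X → ℝ≥0∞) : γ.integralOn s t ρ ≤ γ.integral ρ :=
  lintegral_mono_set (Icc_subset_Icc hs ht)

theorem integral_tsum [MeasurableSpace X] [BorelSpace X] {ι : Type*} [Countable ι]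
    (γ : RectCurve X) {ρ : ι → X → ℝ≥0∞} (hρ : ∀ i, Measurable (ρ i)) :
    γ.integral (fun x => ∑' i, ρ i x) = ∑' i, γ.integral (ρ i) :=
  lintegral_tsum fun i => (hρ i).comp_aemeasurable γ.aemeasurable

end RectCurve

section Modulus

variable {X : Type*} [MetricSpace X] [MeasurableSpace X] {μ : Measure X}

theorem modOne_le_lintegral {Γ : Set (RectCurve X)} {ρ : X → ℝ≥0∞} (hρ : Measurable ρ)
    (h : ∀ γ ∈ Γ, 1 ≤ γ.integral ρ) : modOne μ Γ ≤ ∫⁻ x, ρ x ∂μ :=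
  iInf₂_le_of_le ρ hρ (iInf_le _ h)

theorem exists_lintegral_lt_of_modOne_lt {Γ : Set (RectCurve X)} {c : ℝ≥0∞} (h : modOne μ Γ < c) :
    ∃ ρ : X → ℝ≥0∞, Measurable ρ ∧ (∀ γ ∈ Γ, 1 ≤ γ.integral ρ) ∧ ∫⁻ x, ρ x ∂μ < c := by
  simpa only [modOne, iInf_lt_iff, exists_prop] using h

theorem modOne_empty : modOne μ (∅ : Set (RectCurve X)) = 0 :=
  nonpos_iff_eq_zero.1 <| (modOne_le_lintegral measurable_const (by simp)).trans_eq lintegral_zero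

theorem modAM_le_modOne (Γ : Set (RectCurve X)) : modAM μ Γ ≤ modOne μ Γ :=
  le_iInf₂ fun ρ hρ => le_iInf fun hΓ => iInf₂_le_of_le (fun _ => ρ) (fun _ => hρ)
    (iInf_le_of_le (fun γ hγ => by simpa using hΓ γ hγ) (by simp))

theorem modOne_le_of_forall_exists_subcurve {Γ Γ' : Set (RectCurve X)}
    (h : ∀ γ ∈ Γ', ∃ s t hs hst ht, γ.subcurve s t hs hst ht ∈ Γ) : modOne μ Γ' ≤ modOne μ Γ := by
  refine le_iInf₂ fun ρ hρ => le_iInf fun hΓ => modOne_le_lintegral hρ fun γ hγ => ?_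
  obtain ⟨s, t, hs, hst, ht, hsub⟩ := h γ hγ
  calc 1 ≤ (γ.subcurve s t hs hst ht).integral ρ := hΓ _ hsub
    _ = γ.integralOn s t ρ := γ.integral_subcurve hs hst ht ρ
    _ ≤ γ.integral ρ := γ.integralOn_le_integral hs ht ρ

variable [BorelSpace X]

theorem modOne_iUnion_le {ι : Type*} [Countable ι] (Γ : ι → Set (RectCurve X)) :
    modOne μ (⋃ i, Γ i) ≤ ∑' i, modOne μ (Γ i) := by
  refine ENNReal.le_of_forall_pos_le_add fun ε hε hfin => ?_
  obtain ⟨δ, hδ, hδε⟩ := ENNReal.exists_pos_sum_of_countable' (ENNReal.coe_ne_zero.2 hε.ne') ι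
  choose ρ hρ hΓ hlt using fun i => exists_lintegral_lt_of_modOne_lt <|
    ENNReal.lt_add_right (ENNReal.ne_top_of_tsum_ne_top hfin.ne i) (hδ i).ne'
  have hadm : ∀ γ ∈ ⋃ i, Γ i, 1 ≤ γ.integral fun x => ∑' i, ρ i x := fun γ hγ => by
    obtain ⟨i, hi⟩ := mem_iUnion.1 hγ
    rw [γ.integral_tsum hρ]
    exact (hΓ i γ hi).trans (ENNReal.le_tsum i)
  calc modOne μ (⋃ i, Γ i) ≤ ∫⁻ x, ∑' i, ρ i x ∂μ := modOne_le_lintegral (.tsum hρ) hadm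
    _ = ∑' i, ∫⁻ x, ρ i x ∂μ := lintegral_tsum fun i => (hρ i).aemeasurable
    _ ≤ ∑' i, (modOne μ (Γ i) + δ i) := ENNReal.tsum_le_tsum fun i => (hlt i).le
    _ ≤ ∑' i, modOne μ (Γ i) + ε := by rw [ENNReal.tsum_add]; gcongr

variable (μ) in
/-- The `1`-modulus as an outer measure on the space of curves, so that `∀ᵐ γ ∂modOneOuter μ, p γ`
expresses that `p` holds for `1`-a.e. curve. -/
def modOneOuter : OuterMeasure (RectCurve X) where
  measureOf := modOne μ
  empty := modOne_empty
  mono h := le_iInf₂ fun _ hρ => le_iInf fun hΓ => modOne_le_lintegral hρ fun γ hγ => hΓ γ (h hγ)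
  iUnion_nat Γ _ := modOne_iUnion_le Γ

theorem ae_modOneOuter_iff {p : RectCurve X → Prop} :
    (∀ᵐ γ ∂modOneOuter μ, p γ) ↔ modOne μ {γ | ¬ p γ} = 0 :=
  Iff.rfl

/-- The density `∞ · 1_N` of a null set `N` excludes all curves that spend positive length
in `N`. -/
theorem ae_curve_ae_of_ae {p : X → Prop} (h : ∀ᵐ x ∂μ, p x) :
    ∀ᵐ γ ∂modOneOuter μ, ∀ᵐ r ∂volume.restrict (Icc 0 γ.length), p (γ.toFun r) := by
  set N := toMeasurable μ {x | ¬ p x}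
  have hN : MeasurableSet N := measurableSet_toMeasurable _ _
  have hρ : Measurable (N.indicator fun _ => (∞ : ℝ≥0∞)) := measurable_const.indicator hN
  have hint : ∫⁻ x, N.indicator (fun _ => ∞) x ∂μ = 0 := by
    rw [lintegral_indicator_const hN, measure_toMeasurable, ae_iff.1 h, mul_zero]
  refine ae_modOneOuter_iff.2 <| nonpos_iff_eq_zero.1 <|
    (modOne_le_lintegral hρ fun γ hγ => ?_).trans_eq hint
  by_contra! hlt
  have hfin := ae_lt_top' (hρ.comp_aemeasurable γ.aemeasurable) (hlt.trans ENNReal.one_lt_top).ne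
  refine hγ ?_
  filter_upwards [hfin] with r hr
  by_contra hp
  simp [N, subset_toMeasurable μ {x | ¬ p x} hp] at hr

theorem IsWeakUpperGradient.ae_forall_subcurve {v : X → ℝ} {g : X → ℝ≥0∞}
    (hg : IsWeakUpperGradient μ v g) :
    ∀ᵐ γ ∂modOneOuter μ, ∀ s t, 0 ≤ s → s < t → t ≤ γ.length →
      ENNReal.ofReal |v (γ.toFun t) - v (γ.toFun s)| ≤ γ.integralOn s t g := by
  refine ae_modOneOuter_iff.2 <| nonpos_iff_eq_zero.1 <| hg.2 ▸
    modOne_le_of_forall_exists_subcurve fun γ hγ => ?_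
  simp only [mem_ofPred_eq, not_forall] at hγ
  obtain ⟨s, t, hs, hst, ht, hlt⟩ := hγ
  refine ⟨s, t, hs, hst, ht, fun hle => hlt ?_⟩
  rw [RectCurve.integral_subcurve] at hle
  simpa [RectCurve.subcurve, abs_sub_comm] using hle

end Modulus

section Comparison

variable {X : Type*} [MetricSpace X] [MeasurableSpace X] [BorelSpace X] {μ : Measure X}

theorem isBVAMUpperBound_of_ae_tendsto {v : ℕ → X → ℝ} {u : X → ℝ} {g : ℕ → X → ℝ≥0∞}
    (hvu : ∀ᵐ x ∂μ, Tendsto (fun i => v i x) atTop (𝓝 (u x)))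
    (hg : ∀ i, IsWeakUpperGradient μ (v i) (g i)) (hfin : ∀ i, ∫⁻ x, g i x ∂μ < ∞)
    (hlim : liminf (fun i => ∫⁻ x, g i x ∂μ) atTop < ∞) : IsBVAMUpperBound μ u g := by
  have hcurve : ∀ᵐ γ ∂modOneOuter μ, ∃ E : Set ℝ, volume E = 0 ∧
      ∀ s ∈ Icc 0 γ.length \ E, ∀ t ∈ Icc 0 γ.length \ E, s < t →
        ENNReal.ofReal |u (γ.toFun t) - u (γ.toFun s)| ≤
          liminf (fun i => γ.integralOn s t (g i)) atTop := by
    filter_upwards [ae_curve_ae_of_ae hvu, ae_all_iff.2 fun i => (hg i).ae_forall_subcurve]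
      with γ hlimγ hgγ
    rw [ae_restrict_iff' measurableSet_Icc] at hlimγ
    refine ⟨_, hlimγ, fun s hs t ht hst => ?_⟩
    have hus := not_not.1 hs.2 hs.1
    have hut := not_not.1 ht.2 ht.1
    rw [← (ENNReal.tendsto_ofReal (hut.sub hus).abs).liminf_eq]
    exact liminf_le_liminf (.of_forall fun i => hgγ i s t hs.1.1 hst ht.1.2)
  exact ⟨fun i => (hg i).1, hfin, hlim, _,
    nonpos_iff_eq_zero.1 ((modAM_le_modOne _).trans_eq (ae_modOneOuter_iff.1 hcurve)),
    fun _ hγ => not_not.1 hγ⟩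

theorem ae_tendsto_of_tsum_setLIntegral_ne_top {α E : Type*} [MeasurableSpace α]
    [NormedAddCommGroup E] {ν : Measure α} {B : ℕ → Set α} (hB : ∀ k, MeasurableSet (B k))
    (hcov : ∀ x, ∀ᶠ k in atTop, x ∈ B k) {v : ℕ → α → E} {u : α → E}
    (hv : ∀ k, AEStronglyMeasurable (v k) ν) (hu : AEStronglyMeasurable u ν)
    (hsum : ∑' k, ∫⁻ x in B k, ‖v k x - u x‖ₑ ∂ν ≠ ∞) :
    ∀ᵐ x ∂ν, Tendsto (fun k => v k x) atTop (𝓝 (u x)) := by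
  have hmeas : ∀ k, AEMeasurable ((B k).indicator fun x => ‖v k x - u x‖ₑ) ν := fun k =>
    ((hv k).sub hu).enorm.indicator (hB k)
  simp_rw [← lintegral_indicator (hB _)] at hsum
  rw [← lintegral_tsum hmeas] at hsum
  filter_upwards [ae_lt_top' (.tsum hmeas) hsum] with x hx
  rw [tendsto_iff_edist_tendsto_0]
  refine (ENNReal.tendsto_atTop_zero_of_tsum_ne_top hx.ne).congr' ?_
  filter_upwards [hcov x] with k hk
  rw [indicator_of_mem hk, edist_eq_enorm_sub]

theorem TendstoL1Loc.exists_subseq_ae_tendsto {v : ℕ → X → ℝ} {u : X → ℝ}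
    (h : TendstoL1Loc μ v u) (hv : ∀ i, AEStronglyMeasurable (v i) μ)
    (hu : AEStronglyMeasurable u μ) :
    ∃ φ : ℕ → ℕ, StrictMono φ ∧ ∀ᵐ x ∂μ, Tendsto (fun k => v (φ k) x) atTop (𝓝 (u x)) := by
  rcases isEmpty_or_nonempty X with _ | ⟨⟨x₀⟩⟩
  · exact ⟨id, strictMono_id, .of_forall isEmptyElim⟩
  obtain ⟨δ, hδ, hδsum⟩ := ENNReal.exists_pos_sum_of_countable' (one_ne_zero (α := ℝ≥0∞)) ℕ
  obtain ⟨φ, hφ, hlt⟩ := extraction_forall_of_eventually fun k : ℕ =>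
    (h x₀ k).eventually_lt_const (hδ k)
  have hcov : ∀ x, ∀ᶠ k : ℕ in atTop, x ∈ Metric.ball x₀ k := fun x =>
    tendsto_natCast_atTop_atTop.eventually_gt_atTop (dist x x₀)
  refine ⟨φ, hφ, ae_tendsto_of_tsum_setLIntegral_ne_top (fun _ => Metric.isOpen_ball.measurableSet)
    hcov (fun k => hv (φ k)) hu (ne_top_of_lt (b := 1) ?_)⟩
  exact (ENNReal.tsum_le_tsum fun k => (hlt k).le).trans_lt hδsum

theorem exists_subseq_lt_liminf_add {a : ℕ → ℝ≥0∞} (ha : liminf a atTop ≠ ∞) {ε : ℕ → ℝ≥0∞}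
    (hε : ∀ k, ε k ≠ 0) : ∃ φ : ℕ → ℕ, StrictMono φ ∧ ∀ k, a (φ k) < liminf a atTop + ε k :=
  extraction_forall_of_frequently fun k =>
    frequently_lt_of_liminf_lt (by isBoundedDefault) (ENNReal.lt_add_right ha (hε k))

theorem totalVarAM_le_totalVar {u : X → ℝ} (hu : AEStronglyMeasurable u μ) :
    totalVarAM μ u ≤ totalVar μ u := by
  refine le_iInf₂ fun v hv => le_iInf fun hvu => ?_
  set a : ℕ → ℝ≥0∞ :=
    fun i => ⨅ (g : X → ℝ≥0∞) (_ : IsWeakUpperGradient μ (v i) g), ∫⁻ x, g x ∂μ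
  change totalVarAM μ u ≤ liminf a atTop
  rcases eq_or_ne (liminf a atTop) ∞ with htop | htop
  · exact htop ▸ le_top
  obtain ⟨φ, hφ, hφa⟩ := exists_subseq_lt_liminf_add htop
    fun k : ℕ => pow_ne_zero k (ENNReal.inv_ne_zero.2 ENNReal.ofNat_ne_top : (2⁻¹ : ℝ≥0∞) ≠ 0)
  have hvφ : TendstoL1Loc μ (fun k => v (φ k)) u := fun x r => (hvu x r).comp hφ.tendsto_atTop
  obtain ⟨ψ, hψ, hae⟩ := hvφ.exists_subseq_ae_tendsto
    (fun k => (hv (φ k)).continuous.aestronglyMeasurable) hu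
  choose g hg hga using fun k => show ∃ g, IsWeakUpperGradient μ (v (φ (ψ k))) g ∧
      ∫⁻ x, g x ∂μ < liminf a atTop + 2⁻¹ ^ ψ k by
    simpa only [a, iInf_lt_iff, exists_prop] using hφa (ψ k)
  have hbound : Tendsto (fun k => liminf a atTop + 2⁻¹ ^ ψ k) atTop (𝓝 (liminf a atTop)) := by
    simpa using ((ENNReal.tendsto_pow_atTop_nhds_zero_of_lt_one (by simp)).comp
      hψ.tendsto_atTop).const_add (liminf a atTop)
  have hle : liminf (fun k => ∫⁻ x, g k x ∂μ) atTop ≤ liminf a atTop :=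
    (liminf_le_liminf (.of_forall fun k => (hga k).le)).trans_eq hbound.liminf_eq
  exact (iInf₂_le g (isBVAMUpperBound_of_ae_tendsto hae hg
    (fun k => (hga k).trans_le le_top) (hle.trans_lt htop.lt_top))).trans hle

end Comparison

section UpperGradient

theorem edist_le_setLIntegral_Icc_of_open_cover {E ι : Type*} [PseudoEMetricSpace E] {f : ℝ → E}
    {h : ℝ → ℝ≥0∞} {a b : ℝ} (hab : a ≤ b) {V : ι → Set (Icc a b)} (hV : ∀ i, IsOpen (V i))
    (hcov : univ ⊆ ⋃ i, V i) (hle : ∀ i, ∀ s t : Icc a b, s ≤ t → Icc s t ⊆ V i →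
      edist (f s) (f t) ≤ ∫⁻ r in Icc (s : ℝ) t, h r) :
    edist (f a) (f b) ≤ ∫⁻ r in Icc a b, h r := by
  obtain ⟨t, ht0, hmono, ⟨m, hm⟩, hsub⟩ := exists_monotone_Icc_subset_open_cover_Icc hab hV hcov
  have hpartial : ∀ n, edist (f a) (f (t n)) ≤ ∫⁻ r in Icc a (t n), h r := by
    intro n
    induction n with
    | zero => simp [ht0]
    | succ n ih =>
      have hn : (t n : ℝ) ≤ t (n + 1) := hmono n.le_succ
      obtain ⟨i, hi⟩ := hsub n
      calc edist (f a) (f (t (n + 1))) ≤ edist (f a) (f (t n)) + edist (f (t n)) (f (t (n + 1))) :=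
            edist_triangle _ _ _
        _ ≤ (∫⁻ r in Icc a (t n), h r) + ∫⁻ r in Ioc (t n : ℝ) (t (n + 1)), h r := by
            rw [restrict_Ioc_eq_restrict_Icc]
            exact add_le_add ih (hle i _ _ hn hi)
        _ = ∫⁻ r in Icc a (t (n + 1)), h r := by
            rw [← lintegral_union measurableSet_Ioc, Icc_union_Ioc_eq_Icc (t n).2.1 hn]
            exact disjoint_left.2 fun r hr hr' => hr'.1.not_ge hr.2
  simpa only [hm m le_rfl] using hpartial m

variable {X : Type*} [MetricSpace X]

theorem RectCurve.edist_le_integral_of_lipschitzOnWith {E ι : Type*} [PseudoEMetricSpace E]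
    {U : ι → Set X} (hU : ∀ i, IsOpen (U i)) (hcov : ⋃ i, U i = univ) {v : X → E} {c : ι → ℝ≥0}
    (hv : ∀ i, LipschitzOnWith (c i) v (U i)) {g : X → ℝ≥0∞} (hg : ∀ i, ∀ x ∈ U i, c i ≤ g x)
    (γ : RectCurve X) : edist (v (γ.toFun 0)) (v (γ.toFun γ.length)) ≤ γ.integral g := by
  refine edist_le_setLIntegral_Icc_of_open_cover (f := v ∘ γ.toFun) γ.length_pos.le
    (fun i => (hU i).preimage γ.continuousOn.domRestrict)
    (by rw [← preimage_iUnion, hcov, preimage_univ]) fun i s t hst hsub => ?_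
  have hmem : ∀ r ∈ Icc (s : ℝ) t, γ.toFun r ∈ U i := fun r hr =>
    hsub (a := ⟨r, s.2.1.trans hr.1, hr.2.trans t.2.2⟩) hr
  calc edist (v (γ.toFun s)) (v (γ.toFun t))
      ≤ c i * edist (γ.toFun s) (γ.toFun t) := hv i (hmem _ ⟨le_rfl, hst⟩) (hmem _ ⟨hst, le_rfl⟩)
    _ ≤ c i * edist (s : ℝ) t := by
        gcongr
        simpa using γ.lipschitzOnWith s.2 t.2
    _ = ∫⁻ _ in Icc (s : ℝ) t, c i := by
        rw [setLIntegral_const, Real.volume_Icc, edist_comm, edist_dist, Real.dist_eq,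
          abs_of_nonneg (sub_nonneg.2 (Subtype.coe_le_coe.2 hst))]
    _ ≤ ∫⁻ r in Icc (s : ℝ) t, g (γ.toFun r) :=
        setLIntegral_mono' measurableSet_Icc fun r hr => hg i _ (hmem r hr)

theorem isWeakUpperGradient_of_lipschitzOnWith [MeasurableSpace X] {μ : Measure X} {ι : Type*}
    {U : ι → Set X} (hU : ∀ i, IsOpen (U i)) (hcov : ⋃ i, U i = univ) {v : X → ℝ} {c : ι → ℝ≥0}
    (hv : ∀ i, LipschitzOnWith (c i) v (U i)) {g : X → ℝ≥0∞} (hgm : Measurable g)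
    (hg : ∀ i, ∀ x ∈ U i, c i ≤ g x) : IsWeakUpperGradient μ v g := by
  have hnone : {γ : RectCurve X |
      ¬ ENNReal.ofReal |v (γ.toFun 0) - v (γ.toFun γ.length)| ≤ γ.integral g} = ∅ :=
    eq_empty_of_forall_notMem fun γ hγ => hγ <| by
      simpa only [edist_dist, Real.dist_eq] using
        γ.edist_le_integral_of_lipschitzOnWith hU hcov hv hg
  exact ⟨hgm, by rw [hnone, modOne_empty]⟩

end UpperGradient

section Net

variable {X : Type*} [MetricSpace X]

variable (X) in
theorem exists_isSeparated_isCover (δ : ℝ≥0) :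
    ∃ A : Set X, Metric.IsSeparated (δ : ℝ≥0∞) A ∧ Metric.IsCover δ univ A := by
  obtain ⟨A, hA⟩ := zorn_subset {A : Set X | A ⊆ univ ∧ Metric.IsSeparated (δ : ℝ≥0∞) A}
    fun c hc hchain => ⟨⋃₀ c, ⟨subset_univ _, (pairwise_sUnion hchain.directedOn).2
      fun s hs => (hc hs).2⟩, fun _ => subset_sUnion_of_mem⟩
  exact ⟨A, hA.prop.2, .of_maximal_isSeparated hA⟩

theorem iUnion_ball_eq_univ_of_isCover {δ : ℝ≥0} (hδ : 0 < δ) {A : Set X}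
    (hcov : Metric.IsCover δ univ A) :
    ⋃ a : A, Metric.ball (a : X) (2 * δ) = univ := by
  refine univ_subset_iff.1 (hcov.subset_iUnion_closedBall.trans ?_)
  rw [biUnion_eq_iUnion]
  exact iUnion_mono fun a => Metric.closedBall_subset_ball (by linarith [NNReal.coe_pos.2 hδ])

variable [MeasurableSpace X] {μ : Measure X} {CD : ℝ≥0}

theorem IsDoublingWith.measure_ball_pow_le (h : IsDoublingWith μ CD) (x : X) {r : ℝ} (hr : 0 < r)
    (m : ℕ) : μ (Metric.ball x (2 ^ m * r)) ≤ CD ^ m * μ (Metric.ball x r) := by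
  induction m with
  | zero => simp
  | succ m ih =>
    rw [pow_succ', mul_assoc, pow_succ', mul_assoc]
    exact (h x _ (by positivity)).2.2.trans (by gcongr)

theorem IsDoublingWith.measure_ball_le (h : IsDoublingWith μ CD) {x y : X} {r R : ℝ} (hr : 0 < r)
    (m : ℕ) (hm : dist x y + R ≤ 2 ^ m * r) :
    μ (Metric.ball x R) ≤ CD ^ m * μ (Metric.ball y r) :=
  (measure_mono (Metric.ball_subset_ball' (by linarith))).trans (h.measure_ball_pow_le y hr m)

/-- A bound for the number of points of a `δ`-separated set in a ball of radius `K * δ`, in a space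
with doubling constant `CD`. -/
def overlapConst (CD : ℝ≥0) (K : ℝ) : ℝ≥0 := CD ^ ⌈4 * K + 2⌉₊

variable [BorelSpace X] {A : Set X} {δ : ℝ≥0}

/-- The disjoint balls `B(a, δ / 2)` lie in `B(x, (K + 1)δ)` and have comparable measure. -/
theorem IsDoublingWith.encard_inter_ball_le (h : IsDoublingWith μ CD) (hδ : 0 < δ)
    (hA : Metric.IsSeparated (δ : ℝ≥0∞) A) {K : ℝ} (hK : 0 ≤ K) (x : X) :
    ((A ∩ Metric.ball x (K * δ)).encard : ℝ≥0∞) ≤ overlapConst CD K := by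
  set S := A ∩ Metric.ball x (K * δ)
  set m := ⌈4 * K + 2⌉₊
  have hm : 4 * K + 2 ≤ 2 ^ m :=
    (Nat.le_ceil _).trans (by exact_mod_cast (Nat.lt_two_pow_self (n := m)).le)
  set B := Metric.ball x ((K + 1) * δ)
  obtain ⟨hB0, hBtop, -⟩ := h x ((K + 1) * δ) (by positivity)
  have hdisj : Pairwise (Function.onFun Disjoint fun a : S => Metric.ball (a : X) (δ / 2)) :=
    fun a b hab => Metric.ball_disjoint_ball <| by
      have hsep : (δ : ℝ≥0∞) < edist (a : X) b := hA a.2.1 b.2.1 (Subtype.coe_ne_coe.2 hab)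
      rw [edist_nndist, ENNReal.coe_lt_coe, ← NNReal.coe_lt_coe, coe_nndist] at hsep
      linarith
  refine (ENNReal.mul_le_mul_iff_left hB0.ne' hBtop.ne).1 ?_
  calc (S.encard : ℝ≥0∞) * μ B = ∑' _ : S, μ B := (ENNReal.tsum_set_const _ _).symm
    _ ≤ ∑' a : S, (CD : ℝ≥0∞) ^ m * μ (Metric.ball (a : X) (δ / 2)) := by
        refine ENNReal.tsum_le_tsum fun a => h.measure_ball_le (by positivity) m ?_
        have := Metric.mem_ball'.1 a.2.2
        nlinarith
    _ ≤ (CD : ℝ≥0∞) ^ m * μ (⋃ a : S, Metric.ball (a : X) (δ / 2)) := by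
        rw [ENNReal.tsum_mul_left]
        gcongr
        exact tsum_meas_le_meas_iUnion_of_disjoint μ
          (fun _ => Metric.isOpen_ball.measurableSet) hdisj
    _ ≤ (CD : ℝ≥0∞) ^ m * μ B := by
        gcongr
        refine iUnion_subset fun a => Metric.ball_subset_ball' ?_
        have := Metric.mem_ball.1 a.2.2
        linarith
    _ = overlapConst CD K * μ B := by rw [overlapConst, ENNReal.coe_pow]

theorem IsDoublingWith.finite_inter_ball (h : IsDoublingWith μ CD) (hδ : 0 < δ)
    (hA : Metric.IsSeparated (δ : ℝ≥0∞) A) {K : ℝ} (hK : 0 ≤ K) (x : X) :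
    (A ∩ Metric.ball x (K * δ)).Finite := by
  rw [← encard_lt_top_iff, ← ENat.toENNReal_lt_top]
  exact (h.encard_inter_ball_le hδ hA hK x).trans_lt ENNReal.coe_lt_top

theorem IsDoublingWith.countable_of_isSeparated (h : IsDoublingWith μ CD) (hδ : 0 < δ)
    (hA : Metric.IsSeparated (δ : ℝ≥0∞) A) : A.Countable := by
  rcases A.eq_empty_or_nonempty with rfl | ⟨x, -⟩
  · exact countable_empty
  refine (countable_iUnion fun n : ℕ => (h.finite_inter_ball hδ hA n.cast_nonneg x).countable).mono
    fun a ha => ?_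
  obtain ⟨n, hn⟩ := exists_nat_gt (dist a x / δ)
  exact mem_iUnion.2 ⟨n, ha, (div_lt_iff₀ (NNReal.coe_pos.2 hδ)).1 hn⟩

theorem IsDoublingWith.tsum_indicator_ball_le (h : IsDoublingWith μ CD) (hδ : 0 < δ)
    (hA : Metric.IsSeparated (δ : ℝ≥0∞) A) {K : ℝ} (hK : 0 ≤ K) (f : X → ℝ≥0∞) (x : X) :
    ∑' a : A, (Metric.ball (a : X) (K * δ)).indicator f x ≤ overlapConst CD K * f x := by
  classical
  calc ∑' a : A, (Metric.ball (a : X) (K * δ)).indicator f x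
      = ∑' a : X, (A ∩ Metric.ball x (K * δ)).indicator (fun _ => f x) a := by
        rw [tsum_subtype A fun a => (Metric.ball a (K * δ)).indicator f x]
        simp only [indicator_apply, mem_inter_iff, ite_and, Metric.mem_ball']
        simp only [dist_comm]
    _ = (A ∩ Metric.ball x (K * δ)).encard * f x := by
        rw [← tsum_subtype, ENNReal.tsum_set_const]
    _ ≤ overlapConst CD K * f x := by gcongr; exact h.encard_inter_ball_le hδ hA hK x

theorem IsDoublingWith.tsum_setLIntegral_ball_le (h : IsDoublingWith μ CD) (hδ : 0 < δ)
    (hA : Metric.IsSeparated (δ : ℝ≥0∞) A) {K : ℝ} (hK : 0 ≤ K) {f : X → ℝ≥0∞}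
    (hf : Measurable f) :
    ∑' a : A, ∫⁻ x in Metric.ball (a : X) (K * δ), f x ∂μ ≤ overlapConst CD K * ∫⁻ x, f x ∂μ := by
  have : Countable A := (h.countable_of_isSeparated hδ hA).to_subtype
  simp_rw [← lintegral_indicator Metric.isOpen_ball.measurableSet]
  rw [← lintegral_tsum fun a => (hf.indicator Metric.isOpen_ball.measurableSet).aemeasurable,
    ← lintegral_const_mul _ hf]
  exact lintegral_mono (h.tsum_indicator_ball_le hδ hA hK f)

end Net

section DiscreteConvolution

/-- If `M` is the mean with respect to `q`, the difference of the two means is the mean with respect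
to `p` of the deviations from `M`, and `∑ b ∈ F, q b • (z b - M) = 0`. -/
theorem dist_centerMass_centerMass_le {ι E : Type*} [NormedAddCommGroup E] [NormedSpace ℝ E]
    {F : Finset ι} {p q : ι → ℝ} {z : ι → E} {c : E} {η ε : ℝ} (hp : 1 ≤ ∑ b ∈ F, p b)
    (hq : ∀ b ∈ F, 0 ≤ q b) (hq0 : 0 < ∑ b ∈ F, q b) (hpq : ∀ b ∈ F, |p b - q b| ≤ ε)
    (hz : ∀ b ∈ F, dist (z b) c ≤ η) :
    dist (F.centerMass p z) (F.centerMass q z) ≤ 2 * F.card * η * ε := by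
  set M := F.centerMass q z
  have hM : dist M c ≤ η := (convex_closedBall c η).centerMass_mem hq hq0 hz
  have hqM : ∑ b ∈ F, q b • (z b - M) = 0 := by
    simp_rw [smul_sub, Finset.sum_sub_distrib, ← Finset.sum_smul, M, Finset.centerMass,
      smul_inv_smul₀ hq0.ne', sub_self]
  have hsub : F.centerMass p z - M = (∑ b ∈ F, p b)⁻¹ • ∑ b ∈ F, (p b - q b) • (z b - M) := by
    simp_rw [sub_smul, Finset.sum_sub_distrib, hqM, sub_zero, smul_sub, Finset.sum_sub_distrib,
      ← Finset.sum_smul, smul_sub, inv_smul_smul₀ (zero_lt_one.trans_le hp).ne', Finset.centerMass]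
  have hdev : ∀ b ∈ F, ‖(p b - q b) • (z b - M)‖ ≤ ε * (2 * η) := fun b hb => by
    rw [norm_smul, Real.norm_eq_abs, ← dist_eq_norm]
    have hzM : dist (z b) M ≤ 2 * η := by linarith [dist_triangle_right (z b) M c, hz b hb]
    exact mul_le_mul (hpq b hb) hzM dist_nonneg ((abs_nonneg _).trans (hpq b hb))
  rw [dist_eq_norm, hsub, norm_smul, norm_inv, Real.norm_of_nonneg (zero_le_one.trans hp)]
  calc (∑ b ∈ F, p b)⁻¹ * ‖∑ b ∈ F, (p b - q b) • (z b - M)‖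
      ≤ ‖∑ b ∈ F, (p b - q b) • (z b - M)‖ :=
        mul_le_of_le_one_left (norm_nonneg _) (inv_le_one_of_one_le₀ hp)
    _ ≤ F.card • (ε * (2 * η)) := (norm_sum_le _ _).trans (Finset.sum_le_card_nsmul _ _ _ hdev)
    _ = 2 * F.card * η * ε := by rw [nsmul_eq_mul]; ring

variable {X : Type*} [MetricSpace X]

/-- The Lipschitz bump at scale `δ` around `b`: at least `1` on `B(b, δ)` and `0` off
`B(b, 2δ)`. -/
def bump (δ : ℝ≥0) (b x : X) : ℝ := max (2 - dist x b / δ) 0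

theorem bump_nonneg (δ : ℝ≥0) (b x : X) : 0 ≤ bump δ b x := le_max_right _ _

theorem one_le_bump {δ : ℝ≥0} {b x : X} (h : dist x b ≤ δ) : 1 ≤ bump δ b x :=
  le_max_of_le_left (by linarith [div_le_one_of_le₀ h δ.coe_nonneg])

theorem bump_eq_zero {δ : ℝ≥0} (hδ : 0 < δ) {b x : X} (h : 2 * δ ≤ dist x b) : bump δ b x = 0 :=
  max_eq_right (by linarith [(le_div_iff₀ (NNReal.coe_pos.2 hδ)).2 h])

theorem abs_bump_sub_bump_le (δ : ℝ≥0) (b x y : X) :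
    |bump δ b x - bump δ b y| ≤ dist x y / δ := by
  calc |bump δ b x - bump δ b y| ≤ |2 - dist x b / δ - (2 - dist y b / δ)| :=
        abs_max_sub_max_le_abs _ _ _
    _ = |dist x b - dist y b| / δ := by
        rw [sub_sub_sub_cancel_left, ← sub_div, abs_div, abs_of_nonneg δ.coe_nonneg, abs_sub_comm]
    _ ≤ dist x y / δ := by gcongr; exact abs_dist_sub_le _ _ _

variable {E : Type*} [NormedAddCommGroup E] [NormedSpace ℝ E]

/-- The function `∑ b ∈ A, φ_b • w b`, where `(φ_b)` is the partition of unity obtained by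
normalizing the bumps at scale `δ` around the points of `A`. -/
def bumpMean (A : Set X) (δ : ℝ≥0) (w : X → E) (x : X) : E :=
  (∑ᶠ b ∈ A, bump δ b x)⁻¹ • ∑ᶠ b ∈ A, bump δ b x • w b

variable {A : Set X} {δ : ℝ≥0} {w : X → E} {a : X}

theorem finsum_mem_eq_sum_of_bump_eq_zero {M : Type*} [AddCommMonoid M] (hδ : 0 < δ)
    (hfin : (A ∩ Metric.ball a (4 * δ)).Finite) {x : X} (hx : x ∈ Metric.ball a (2 * δ)) {f : X → M}
    (hf : ∀ b, bump δ b x = 0 → f b = 0) : ∑ᶠ b ∈ A, f b = ∑ b ∈ hfin.toFinset, f b := by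
  have hsupp : f.support ⊆ Metric.ball a (4 * δ) := fun b hb => Metric.mem_ball.2 <| by
    have hxb := not_le.1 (mt (fun h => hf b (bump_eq_zero hδ h)) hb)
    linarith [dist_triangle_left b a x, Metric.mem_ball.1 hx]
  refine finsum_mem_eq_sum_of_inter_support_eq f ?_
  rw [hfin.coe_toFinset, inter_assoc, inter_eq_right.2 hsupp]

theorem bumpMean_eq_centerMass (hδ : 0 < δ) (hfin : (A ∩ Metric.ball a (4 * δ)).Finite) {x : X}
    (hx : x ∈ Metric.ball a (2 * δ)) :
    bumpMean A δ w x = hfin.toFinset.centerMass (fun b => bump δ b x) w := by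
  rw [bumpMean, Finset.centerMass, finsum_mem_eq_sum_of_bump_eq_zero hδ hfin hx fun _ => id,
    finsum_mem_eq_sum_of_bump_eq_zero hδ hfin hx fun b hb => by rw [hb, zero_smul]]

theorem one_le_sum_bump (hA : Metric.IsCover δ univ A)
    (hfin : (A ∩ Metric.ball a (4 * δ)).Finite) {x : X} (hx : x ∈ Metric.ball a (2 * δ)) :
    1 ≤ ∑ b ∈ hfin.toFinset, bump δ b x := by
  obtain ⟨b, hbA, hb⟩ := mem_iUnion₂.1 (hA.subset_iUnion_closedBall (mem_univ x))
  rw [Metric.mem_closedBall] at hb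
  have hba : b ∈ Metric.ball a (4 * δ) := Metric.mem_ball.2 <| by
    linarith [dist_triangle_left b a x, Metric.mem_ball.1 hx, δ.coe_nonneg]
  exact (one_le_bump hb).trans <| Finset.single_le_sum (f := fun b => bump δ b x)
    (fun b _ => bump_nonneg δ b x) (hfin.mem_toFinset.2 ⟨hbA, hba⟩)

theorem dist_bumpMean_le (hδ : 0 < δ) (hA : Metric.IsCover δ univ A)
    (hfin : (A ∩ Metric.ball a (4 * δ)).Finite) {c : E} {η : ℝ}
    (hw : ∀ b ∈ A ∩ Metric.ball a (4 * δ), dist (w b) c ≤ η) {x : X}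
    (hx : x ∈ Metric.ball a (2 * δ)) : dist (bumpMean A δ w x) c ≤ η := by
  rw [bumpMean_eq_centerMass hδ hfin hx]
  exact (convex_closedBall c η).centerMass_mem (fun b _ => bump_nonneg δ b x)
    (zero_lt_one.trans_le (one_le_sum_bump hA hfin hx)) fun b hb => hw b (hfin.mem_toFinset.1 hb)

theorem lipschitzOnWith_bumpMean (hδ : 0 < δ) (hA : Metric.IsCover δ univ A)
    (hfin : (A ∩ Metric.ball a (4 * δ)).Finite) {c : E} {η : ℝ≥0}
    (hw : ∀ b ∈ A ∩ Metric.ball a (4 * δ), dist (w b) c ≤ η) :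
    LipschitzOnWith (2 * (A ∩ Metric.ball a (4 * δ)).ncard * η / δ) (bumpMean A δ w)
      (Metric.ball a (2 * δ)) := by
  refine .of_dist_le_mul fun x hx y hy => ?_
  rw [bumpMean_eq_centerMass hδ hfin hx, bumpMean_eq_centerMass hδ hfin hy]
  refine (dist_centerMass_centerMass_le (one_le_sum_bump hA hfin hx)
    (fun b _ => bump_nonneg δ b y) (zero_lt_one.trans_le (one_le_sum_bump hA hfin hy))
    (fun b _ => abs_bump_sub_bump_le δ b x y)
    fun b hb => hw b (hfin.mem_toFinset.1 hb)).trans_eq ?_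
  rw [ncard_eq_toFinset_card _ hfin]
  push_cast
  ring

end DiscreteConvolution

theorem tsum_liminf_le {ι : Type*} [Countable ι] (f : ℕ → ι → ℝ≥0∞) :
    ∑' a, liminf (fun i => f i a) atTop ≤ liminf (fun i => ∑' a, f i a) atTop := by
  let _ : MeasurableSpace ι := ⊤
  simpa only [lintegral_count] using
    lintegral_liminf_le (μ := Measure.count) (u := atTop) fun i => measurable_from_top (f := f i)

section MeanOscillation

variable {X E : Type*} [MeasurableSpace X] {μ : Measure X} [NormedAddCommGroup E] [NormedSpace ℝ E]
  {s t : Set X} {u : X → E}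

theorem enorm_setAverage_sub_le [CompleteSpace E] (h0 : μ s ≠ 0) (htop : μ s ≠ ∞)
    (hu : IntegrableOn u s μ) (c : E) :
    ‖(⨍ z in s, u z ∂μ) - c‖ₑ ≤ ⨍⁻ y in s, ‖u y - c‖ₑ ∂μ := by
  have : IsProbabilityMeasure ((μ s)⁻¹ • μ.restrict s) :=
    ⟨by simp [ENNReal.inv_mul_cancel h0 htop]⟩
  have hu' : Integrable u ((μ s)⁻¹ • μ.restrict s) := hu.smul_measure (ENNReal.inv_ne_top.2 h0)
  have hsub : (⨍ z in s, u z ∂μ) - c = ∫ z, (u z - c) ∂((μ s)⁻¹ • μ.restrict s) := by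
    rw [integral_sub hu' (integrable_const c), setAverage_eq', integral_const, probReal_univ,
      one_smul]
  rw [hsub, setLAverage_eq']
  exact enorm_integral_le_lintegral_enorm _

/-- The mean oscillation `⨍_s |u - u_s| dμ`. -/
def meanOsc (μ : Measure X) (u : X → E) (s : Set X) : ℝ≥0∞ :=
  ⨍⁻ y in s, ‖u y - ⨍ z in s, u z ∂μ‖ₑ ∂μ

theorem meanOsc_mul_measure (htop : μ s ≠ ∞) :
    meanOsc μ u s * μ s = ∫⁻ y in s, ‖u y - ⨍ z in s, u z ∂μ‖ₑ ∂μ := by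
  rw [meanOsc, mul_comm, measure_mul_setLAverage _ htop]

theorem meanOsc_ne_top (h0 : μ s ≠ 0) (htop : μ s ≠ ∞) (hu : IntegrableOn u s μ) :
    meanOsc μ u s ≠ ∞ := by
  rw [meanOsc, setLAverage_eq]
  exact ENNReal.div_ne_top (hu.sub (integrableOn_const htop)).2.ne h0

theorem enorm_setAverage_sub_setAverage_le [CompleteSpace E] (hst : s ⊆ t) (h0 : μ s ≠ 0)
    (htop : μ t ≠ ∞) (hu : IntegrableOn u t μ) {K : ℝ≥0∞} (hK : μ t ≤ K * μ s) :
    ‖(⨍ z in s, u z ∂μ) - ⨍ z in t, u z ∂μ‖ₑ ≤ K * meanOsc μ u t := by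
  have hs : μ s ≠ ∞ := measure_ne_top_of_subset hst htop
  refine (enorm_setAverage_sub_le h0 hs (hu.mono_set hst) _).trans ?_
  rw [setLAverage_eq, ENNReal.div_le_iff h0 hs]
  calc ∫⁻ y in s, ‖u y - ⨍ z in t, u z ∂μ‖ₑ ∂μ
      ≤ ∫⁻ y in t, ‖u y - ⨍ z in t, u z ∂μ‖ₑ ∂μ := lintegral_mono_set hst
    _ = meanOsc μ u t * μ t := (meanOsc_mul_measure htop).symm
    _ ≤ meanOsc μ u t * (K * μ s) := by gcongr
    _ = K * meanOsc μ u t * μ s := by ring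

end MeanOscillation

section DoublingApproximation

variable {X E : Type*} [MetricSpace X] [MeasurableSpace X] {μ : Measure X} {CD δ : ℝ≥0} {A : Set X}
  [NormedAddCommGroup E] [NormedSpace ℝ E] {u : X → E} {a : X}

/-- The discrete convolution of `u` at scale `δ`, with respect to the net `A`. -/
def discreteConvolution (μ : Measure X) (A : Set X) (δ : ℝ≥0) (u : X → E) : X → E :=
  bumpMean A δ fun b => ⨍ z in Metric.ball b δ, u z ∂μ

/-- The total oscillation `∑ a ∈ A, ∫_{B(a, 5δ)} |u - u_{B(a, 5δ)}| dμ` of `u` at scale `δ`. -/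
def oscSum (μ : Measure X) (A : Set X) (δ : ℝ≥0) (u : X → E) : ℝ≥0∞ :=
  ∑' a : A, meanOsc μ u (Metric.ball (a : X) (5 * δ)) * μ (Metric.ball (a : X) (5 * δ))

theorem IsDoublingWith.meanOsc_ball_ne_top (hD : IsDoublingWith μ CD) {r : ℝ} (hr : 0 < r)
    (hu : IntegrableOn u (Metric.ball a r) μ) : meanOsc μ u (Metric.ball a r) ≠ ∞ :=
  meanOsc_ne_top (hD a r hr).1.ne' (hD a r hr).2.1.ne hu

variable [CompleteSpace E]

theorem IsDoublingWith.dist_setAverage_ball_le (hD : IsDoublingWith μ CD) (hδ : 0 < δ)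
    (hu : IntegrableOn u (Metric.ball a (5 * δ)) μ) {b : X} (hb : b ∈ Metric.ball a (4 * δ)) :
    dist (⨍ z in Metric.ball b δ, u z ∂μ) (⨍ z in Metric.ball a (5 * δ), u z ∂μ) ≤
      (CD ^ 4 * (meanOsc μ u (Metric.ball a (5 * δ))).toNNReal : ℝ≥0) := by
  have hδ' : (0 : ℝ) < δ := hδ
  have hba := Metric.mem_ball.1 hb
  rw [← coe_nndist, NNReal.coe_le_coe, ← edist_le_coe, edist_eq_enorm_sub, ENNReal.coe_mul,
    ENNReal.coe_pow, ENNReal.coe_toNNReal (hD.meanOsc_ball_ne_top (by positivity) hu)]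
  refine enorm_setAverage_sub_setAverage_le (Metric.ball_subset_ball' (by linarith))
    (hD b δ hδ').1.ne' (hD a (5 * δ) (by positivity)).2.1.ne hu (hD.measure_ball_le hδ' 4 ?_)
  rw [dist_comm]
  linarith

variable [BorelSpace X]

theorem IsDoublingWith.enorm_discreteConvolution_sub_le (hD : IsDoublingWith μ CD) (hδ : 0 < δ)
    (hsep : Metric.IsSeparated (δ : ℝ≥0∞) A) (hcov : Metric.IsCover δ univ A)
    (hu : IntegrableOn u (Metric.ball a (5 * δ)) μ) {x : X} (hx : x ∈ Metric.ball a (2 * δ)) :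
    ‖discreteConvolution μ A δ u x - ⨍ z in Metric.ball a (5 * δ), u z ∂μ‖ₑ ≤
      CD ^ 4 * meanOsc μ u (Metric.ball a (5 * δ)) := by
  have hfin := hD.finite_inter_ball hδ hsep (by norm_num : (0 : ℝ) ≤ 4) a
  have h := dist_bumpMean_le hδ hcov hfin (fun b hb => hD.dist_setAverage_ball_le hδ hu hb.2) hx
  rwa [← coe_nndist, NNReal.coe_le_coe, ← edist_le_coe, edist_eq_enorm_sub, ENNReal.coe_mul,
    ENNReal.coe_pow, ENNReal.coe_toNNReal (hD.meanOsc_ball_ne_top (by positivity) hu)] at h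

theorem IsDoublingWith.lipschitzOnWith_discreteConvolution (hD : IsDoublingWith μ CD) (hδ : 0 < δ)
    (hsep : Metric.IsSeparated (δ : ℝ≥0∞) A) (hcov : Metric.IsCover δ univ A)
    (hu : IntegrableOn u (Metric.ball a (5 * δ)) μ) :
    LipschitzOnWith
      (2 * overlapConst CD 4 * (CD ^ 4 * (meanOsc μ u (Metric.ball a (5 * δ))).toNNReal) / δ)
      (discreteConvolution μ A δ u) (Metric.ball a (2 * δ)) := by
  have h4 : (0 : ℝ) ≤ 4 := by norm_num
  have hfin := hD.finite_inter_ball hδ hsep h4 a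
  have hcard : ((A ∩ Metric.ball a (4 * δ)).ncard : ℝ≥0) ≤ overlapConst CD 4 := by
    have h := hD.encard_inter_ball_le hδ hsep h4 a
    rwa [← hfin.cast_ncard_eq, ENat.toENNReal_coe, ← ENNReal.coe_natCast, ENNReal.coe_le_coe] at h
  refine (lipschitzOnWith_bumpMean hδ hcov hfin fun b hb =>
    hD.dist_setAverage_ball_le hδ hu hb.2).weaken ?_
  gcongr

theorem IsDoublingWith.locallyLipschitz_discreteConvolution (hD : IsDoublingWith μ CD) (hδ : 0 < δ)
    (hsep : Metric.IsSeparated (δ : ℝ≥0∞) A) (hcov : Metric.IsCover δ univ A)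
    (hu : ∀ x r, IntegrableOn u (Metric.ball x r) μ) :
    LocallyLipschitz (discreteConvolution μ A δ u) := fun x =>
  ⟨_, _, Metric.ball_mem_nhds x (by positivity),
    hD.lipschitzOnWith_discreteConvolution hδ hsep hcov (hu x _)⟩

theorem IsDoublingWith.lintegral_discreteConvolution_sub_le (hD : IsDoublingWith μ CD) (hδ : 0 < δ)
    (hsep : Metric.IsSeparated (δ : ℝ≥0∞) A) (hcov : Metric.IsCover δ univ A)
    (hu : ∀ x r, IntegrableOn u (Metric.ball x r) μ) :
    ∫⁻ x, ‖discreteConvolution μ A δ u x - u x‖ₑ ∂μ ≤ (CD ^ 4 + 1) * oscSum μ A δ u := by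
  have : Countable A := (hD.countable_of_isSeparated hδ hsep).to_subtype
  have hball : ∀ a : X, ∫⁻ x in Metric.ball a (2 * δ), ‖discreteConvolution μ A δ u x - u x‖ₑ ∂μ ≤
      (CD ^ 4 + 1) *
        (meanOsc μ u (Metric.ball a (5 * δ)) * μ (Metric.ball a (5 * δ))) := fun a => by
    set B := Metric.ball a (5 * δ)
    calc ∫⁻ x in Metric.ball a (2 * δ), ‖discreteConvolution μ A δ u x - u x‖ₑ ∂μ
        ≤ ∫⁻ x in Metric.ball a (2 * δ),
            (CD ^ 4 * meanOsc μ u B + ‖u x - ⨍ z in B, u z ∂μ‖ₑ) ∂μ := by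
          refine setLIntegral_mono' Metric.isOpen_ball.measurableSet fun x hx => ?_
          rw [← sub_sub_sub_cancel_right _ (u x) (⨍ z in B, u z ∂μ)]
          exact enorm_sub_le.trans <| by
            gcongr
            exact hD.enorm_discreteConvolution_sub_le hδ hsep hcov (hu a _) hx
      _ ≤ ∫⁻ x in B, (CD ^ 4 * meanOsc μ u B + ‖u x - ⨍ z in B, u z ∂μ‖ₑ) ∂μ :=
          lintegral_mono_set (Metric.ball_subset_ball (by gcongr; norm_num))
      _ = (CD ^ 4 + 1) * (meanOsc μ u B * μ B) := by
          rw [lintegral_add_left measurable_const, setLIntegral_const,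
            ← meanOsc_mul_measure (hD a _ (by positivity)).2.1.ne]
          ring
  calc ∫⁻ x, ‖discreteConvolution μ A δ u x - u x‖ₑ ∂μ
      = ∫⁻ x in ⋃ a : A, Metric.ball (a : X) (2 * δ),
          ‖discreteConvolution μ A δ u x - u x‖ₑ ∂μ := by
        rw [iUnion_ball_eq_univ_of_isCover hδ hcov, Measure.restrict_univ]
    _ ≤ ∑' a : A, ∫⁻ x in Metric.ball (a : X) (2 * δ),
          ‖discreteConvolution μ A δ u x - u x‖ₑ ∂μ := lintegral_iUnion_le _ _
    _ ≤ (CD ^ 4 + 1) * oscSum μ A δ u := by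
        rw [oscSum, ← ENNReal.tsum_mul_left]
        exact ENNReal.tsum_le_tsum fun a => hball a

end DoublingApproximation

section TotalVariation

variable {X : Type*} [MetricSpace X] [MeasurableSpace X] [BorelSpace X] {μ : Measure X}
  {CD δ : ℝ≥0} {A : Set X} {u : X → ℝ}

theorem IsDoublingWith.iInf_isWeakUpperGradient_discreteConvolution_le
    (hD : IsDoublingWith μ CD) (hδ : 0 < δ) (hsep : Metric.IsSeparated (δ : ℝ≥0∞) A)
    (hcov : Metric.IsCover δ univ A) (hu : ∀ x r, IntegrableOn u (Metric.ball x r) μ) :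
    ⨅ (G : X → ℝ≥0∞) (_ : IsWeakUpperGradient μ (discreteConvolution μ A δ u) G), ∫⁻ x, G x ∂μ ≤
      2 * overlapConst CD 4 * CD ^ 4 / δ * oscSum μ A δ u := by
  have : Countable A := (hD.countable_of_isSeparated hδ hsep).to_subtype
  have hδ0 : δ ≠ 0 := hδ.ne'
  set L : A → ℝ≥0 := fun a =>
    2 * overlapConst CD 4 * (CD ^ 4 * (meanOsc μ u (Metric.ball a (5 * δ))).toNNReal) / δ
  set b : A → X → ℝ≥0∞ := fun a => (Metric.ball (a : X) (2 * δ)).indicator fun _ => (L a : ℝ≥0∞)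
  have hb : ∀ a, Measurable (b a) := fun a =>
    measurable_const.indicator Metric.isOpen_ball.measurableSet
  have hG : IsWeakUpperGradient μ (discreteConvolution μ A δ u) fun x => ∑' a, b a x :=
    isWeakUpperGradient_of_lipschitzOnWith (fun _ => Metric.isOpen_ball)
      (iUnion_ball_eq_univ_of_isCover hδ hcov)
      (fun a => hD.lipschitzOnWith_discreteConvolution hδ hsep hcov (hu a _)) (.tsum hb)
      fun a x hx => (indicator_of_mem hx fun _ => (L a : ℝ≥0∞)).ge.trans
        (ENNReal.le_tsum (f := fun a => b a x) a)
  have hL : ∀ a, (L a : ℝ≥0∞) =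
      2 * overlapConst CD 4 * CD ^ 4 / δ * meanOsc μ u (Metric.ball a (5 * δ)) := fun a => by
    rw [ENNReal.coe_div hδ0, ENNReal.div_eq_inv_mul, ENNReal.div_eq_inv_mul]
    push_cast
    rw [ENNReal.coe_toNNReal (hD.meanOsc_ball_ne_top (by positivity) (hu a _))]
    ring
  calc _ ≤ ∫⁻ x, ∑' a, b a x ∂μ := iInf₂_le _ hG
    _ = ∑' a, ∫⁻ x, b a x ∂μ := lintegral_tsum fun a => (hb a).aemeasurable
    _ ≤ ∑' a : A, 2 * overlapConst CD 4 * CD ^ 4 / δ *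
          (meanOsc μ u (Metric.ball (a : X) (5 * δ)) * μ (Metric.ball (a : X) (5 * δ))) := by
        refine ENNReal.tsum_le_tsum fun a => ?_
        rw [lintegral_indicator_const Metric.isOpen_ball.measurableSet, hL,
          mul_assoc _ (meanOsc _ _ _)]
        gcongr
        norm_num
    _ = 2 * overlapConst CD 4 * CD ^ 4 / δ * oscSum μ A δ u := ENNReal.tsum_mul_left

theorem IsDoublingWith.totalVar_le_of_forall_oscSum_le (hD : IsDoublingWith μ CD)
    (hu : ∀ x r, IntegrableOn u (Metric.ball x r) μ) {V : ℝ≥0∞} (hV : V ≠ ∞)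
    (hosc : ∀ (δ : ℝ≥0) (A : Set X), 0 < δ → Metric.IsSeparated (δ : ℝ≥0∞) A →
      oscSum μ A δ u ≤ V * δ) :
    totalVar μ u ≤ 2 * overlapConst CD 4 * CD ^ 4 * V := by
  obtain ⟨δ, -, hδ, hδ0⟩ := exists_seq_strictAnti_tendsto (0 : ℝ≥0)
  choose A hsep hcov using fun n => exists_isSeparated_isCover X (δ n)
  have hlim : Tendsto (fun n => (CD ^ 4 + 1 : ℝ≥0∞) * (V * δ n)) atTop (𝓝 0) := by
    simpa only [ENNReal.coe_zero, mul_zero] using ENNReal.Tendsto.const_mul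
      (ENNReal.Tendsto.const_mul (ENNReal.tendsto_coe.2 hδ0) (.inr hV)) (.inr (by finiteness))
  have hconv : TendstoL1Loc μ (fun n => discreteConvolution μ (A n) (δ n) u) u := fun x r =>
    tendsto_of_tendsto_of_tendsto_of_le_of_le tendsto_const_nhds hlim (fun _ => zero_le) fun n =>
      (setLIntegral_le_lintegral _ _).trans <|
        (hD.lintegral_discreteConvolution_sub_le (hδ n) (hsep n) (hcov n) hu).trans <| by
          gcongr; exact hosc _ _ (hδ n) (hsep n)
  refine (iInf₂_le_of_le _ (fun n =>
    hD.locallyLipschitz_discreteConvolution (hδ n) (hsep n) (hcov n) hu) (iInf_le _ hconv)).trans ?_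
  refine (liminf_le_liminf (.of_forall fun n => ?_)).trans_eq (liminf_const _)
  have hδn : (δ n : ℝ≥0∞) ≠ 0 := ENNReal.coe_ne_zero.2 (hδ n).ne'
  calc _ ≤ 2 * overlapConst CD 4 * CD ^ 4 / δ n * oscSum μ (A n) (δ n) u :=
        hD.iInf_isWeakUpperGradient_discreteConvolution_le (hδ n) (hsep n) (hcov n) hu
    _ ≤ 2 * overlapConst CD 4 * CD ^ 4 / δ n * (δ n * V) := by
        rw [mul_comm (δ n : ℝ≥0∞)]
        gcongr
        exact hosc _ _ (hδ n) (hsep n)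
    _ = 2 * overlapConst CD 4 * CD ^ 4 * V := by
        rw [← mul_assoc, ENNReal.div_mul_cancel hδn ENNReal.coe_ne_top]

end TotalVariation

section Poincare

variable {X : Type*} [MetricSpace X] [MeasurableSpace X] {μ : Measure X} {CD CP δ : ℝ≥0} {lam : ℝ}
  {A : Set X} {u : X → ℝ} {g : ℕ → X → ℝ≥0∞}

theorem AMPoincareWith.meanOsc_mul_measure_le (hP : AMPoincareWith μ CP lam)
    (hD : IsDoublingWith μ CD) (hlam : 1 ≤ lam) (hu : LocallyIntegrable u μ)
    (hg : IsBVAMUpperBound μ u g) (x : X) {r : ℝ} (hr : 0 < r) :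
    meanOsc μ u (Metric.ball x r) * μ (Metric.ball x r) ≤
      CP * ENNReal.ofReal r *
        liminf (fun i => ∫⁻ y in Metric.ball x (lam * r), g i y ∂μ) atTop := by
  have hfin : μ (Metric.ball x (lam * r)) ≠ ∞ := (hD x (lam * r) (by positivity)).2.1.ne
  calc meanOsc μ u (Metric.ball x r) * μ (Metric.ball x r)
      ≤ (CP * ENNReal.ofReal r *
          liminf (fun i => ⨍⁻ y in Metric.ball x (lam * r), g i y ∂μ) atTop) *
            μ (Metric.ball x (lam * r)) := by
        gcongr
        · exact hP u g hu hg x r hr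
        · exact le_mul_of_one_le_left hr.le hlam
    _ = CP * ENNReal.ofReal r *
          liminf (fun i => ∫⁻ y in Metric.ball x (lam * r), g i y ∂μ) atTop := by
        rw [mul_assoc, mul_comm (liminf _ _), ← ENNReal.liminf_const_mul_of_ne_top hfin]
        simp_rw [measure_mul_setLAverage _ hfin]

variable [BorelSpace X]

theorem AMPoincareWith.oscSum_le (hP : AMPoincareWith μ CP lam) (hD : IsDoublingWith μ CD)
    (hlam : 1 ≤ lam) (hu : LocallyIntegrable u μ) (hg : IsBVAMUpperBound μ u g) (hδ : 0 < δ)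
    (hsep : Metric.IsSeparated (δ : ℝ≥0∞) A) :
    oscSum μ A δ u ≤
      5 * CP * overlapConst CD (lam * 5) * liminf (fun i => ∫⁻ x, g i x ∂μ) atTop * δ := by
  have : Countable A := (hD.countable_of_isSeparated hδ hsep).to_subtype
  have hδ5 : ENNReal.ofReal (5 * δ) = 5 * δ := by
    rw [ENNReal.ofReal_mul (by norm_num), ENNReal.ofReal_ofNat, ENNReal.ofReal_coe_nnreal]
  calc oscSum μ A δ u
      ≤ ∑' a : A, CP * (5 * δ) *
          liminf (fun i => ∫⁻ x in Metric.ball (a : X) (lam * 5 * δ), g i x ∂μ) atTop := by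
        simp_rw [← hδ5, mul_assoc lam]
        exact ENNReal.tsum_le_tsum fun a =>
          hP.meanOsc_mul_measure_le hD hlam hu hg a (by positivity)
    _ ≤ CP * (5 * δ) * liminf
          (fun i => ∑' a : A, ∫⁻ x in Metric.ball (a : X) (lam * 5 * δ), g i x ∂μ) atTop := by
        rw [ENNReal.tsum_mul_left]
        gcongr
        exact tsum_liminf_le _
    _ ≤ CP * (5 * δ) * liminf (fun i => overlapConst CD (lam * 5) * ∫⁻ x, g i x ∂μ) atTop := by
        gcongr
        exact liminf_le_liminf <| .of_forall fun i =>
          hD.tsum_setLIntegral_ball_le hδ hsep (by positivity) (hg.1 i)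
    _ = 5 * CP * overlapConst CD (lam * 5) * liminf (fun i => ∫⁻ x, g i x ∂μ) atTop * δ := by
        rw [ENNReal.liminf_const_mul_of_ne_top ENNReal.coe_ne_top]
        ring

/-- The comparison constant `C` in `‖Du‖(X) ≤ C ‖D_AM u‖(X)`, as a function of the doubling
constant and the constants of the `AM`-Poincaré inequality. -/
def comparisonConst (CD CP : ℝ≥0) (lam : ℝ) : ℝ≥0 :=
  max 1 (2 * overlapConst CD 4 * CD ^ 4 * (5 * CP * overlapConst CD (lam * 5)))

theorem one_le_comparisonConst (CD CP : ℝ≥0) (lam : ℝ) : 1 ≤ comparisonConst CD CP lam :=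
  le_max_left _ _

theorem AMPoincareWith.totalVar_le_totalVarAM (hP : AMPoincareWith μ CP lam)
    (hD : IsDoublingWith μ CD) (hlam : 1 ≤ lam)
    (hu : ∀ x r, IntegrableOn u (Metric.ball x r) μ) :
    totalVar μ u ≤ comparisonConst CD CP lam * totalVarAM μ u := by
  have hC0 : (comparisonConst CD CP lam : ℝ≥0∞) ≠ 0 :=
    ENNReal.coe_ne_zero.2 (zero_lt_one.trans_le (one_le_comparisonConst CD CP lam)).ne'
  simp_rw [totalVarAM, ENNReal.mul_iInf_of_ne hC0 ENNReal.coe_ne_top]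
  have hloc : LocallyIntegrable u μ := fun x => ⟨_, Metric.ball_mem_nhds x one_pos, hu x 1⟩
  refine le_iInf₂ fun g hg => ?_
  have hI : liminf (fun i => ∫⁻ x, g i x ∂μ) atTop ≠ ∞ := hg.2.2.1.ne
  calc totalVar μ u
      ≤ 2 * overlapConst CD 4 * CD ^ 4 *
          (5 * CP * overlapConst CD (lam * 5) * liminf (fun i => ∫⁻ x, g i x ∂μ) atTop) :=
        hD.totalVar_le_of_forall_oscSum_le hu (by finiteness) fun _ _ hδ hsep =>
          hP.oscSum_le hD hlam hloc hg hδ hsep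
    _ ≤ comparisonConst CD CP lam * liminf (fun i => ∫⁻ x, g i x ∂μ) atTop := by
        rw [← mul_assoc]
        gcongr
        exact_mod_cast le_max_right _ _

end Poincare

section Membership

variable {X : Type*} [MetricSpace X] [MeasurableSpace X] {μ : Measure X} {u : X → ℝ}

theorem memBVAM_iff : MemBVAM μ u ↔ Integrable u μ ∧ totalVarAM μ u < ∞ := by
  simp only [MemBVAM, totalVarAM, iInf_lt_iff, exists_prop]
  exact and_congr_right fun _ => exists_congr fun g => (and_iff_left_of_imp fun hg => hg.2.2.1).symm

theorem aestronglyMeasurable_of_forall_integrableOn_ball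
    (hu : ∀ x r, IntegrableOn u (Metric.ball x r) μ) : AEStronglyMeasurable u μ := by
  rcases isEmpty_or_nonempty X with _ | ⟨⟨x⟩⟩
  · exact .of_subsingleton_dom
  · rw [← Measure.restrict_univ (μ := μ), ← Metric.iUnion_ball_nat x,
      aestronglyMeasurable_iUnion_iff]
    exact fun n => (hu x n).aestronglyMeasurable

end Membership

end

theorem proposition3p3_general (CD CP : ℝ≥0) (lam : ℝ) (hlam : 1 ≤ lam) :
    ∃ C : ℝ≥0, 1 ≤ C ∧
      ∀ (X : Type*) [MetricSpace X] [MeasurableSpace X] [BorelSpace X] (μ : Measure X),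
        IsDoublingWith μ CD → AMPoincareWith μ CP lam →
        {u : X → ℝ | MemBVAM μ u} = {u : X → ℝ | Integrable u μ ∧ MemBV μ u} ∧
        ∀ u : X → ℝ, (∀ x r, IntegrableOn u (Metric.ball x r) μ) →
          (totalVarAM μ u ≤ C * totalVar μ u ∧ totalVar μ u ≤ C * totalVarAM μ u) ∧
          (normBVAM μ u ≤ C * normBV μ u ∧ normBV μ u ≤ C * normBVAM μ u) := by
  refine ⟨comparisonConst CD CP lam, one_le_comparisonConst CD CP lam, fun X _ _ _ μ hD hP => ?_⟩
  have hC : (1 : ℝ≥0∞) ≤ comparisonConst CD CP lam := mod_cast one_le_comparisonConst CD CP lam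
  have hAM : ∀ {u : X → ℝ}, (∀ x r, IntegrableOn u (Metric.ball x r) μ) →
      totalVarAM μ u ≤ totalVar μ u := fun hu =>
    totalVarAM_le_totalVar (aestronglyMeasurable_of_forall_integrableOn_ball hu)
  have hTV : ∀ {u : X → ℝ}, (∀ x r, IntegrableOn u (Metric.ball x r) μ) →
      totalVar μ u ≤ comparisonConst CD CP lam * totalVarAM μ u :=
    hP.totalVar_le_totalVarAM hD hlam
  refine ⟨Set.ext fun u => memBVAM_iff.trans <| and_congr_right fun hu => ?_, fun u hu => ?_⟩
  · have hu' : ∀ x r, IntegrableOn u (Metric.ball x r) μ := fun _ _ => hu.integrableOn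
    exact ⟨fun h => ⟨hu.locallyIntegrable, (hTV hu').trans_lt
      (ENNReal.mul_lt_top ENNReal.coe_lt_top h)⟩, fun h => (hAM hu').trans_lt h.2⟩
  · refine ⟨⟨(hAM hu).trans (le_mul_of_one_le_left' hC), hTV hu⟩, ?_, ?_⟩
    · exact (add_le_add_right (hAM hu) _).trans (le_mul_of_one_le_left' hC)
    · rw [normBV, normBVAM, mul_add]
      exact add_le_add (le_mul_of_one_le_left' hC) (hTV hu)

theorem proposition3p3 (CD CP : ℝ≥0) (lam : ℝ) (hCP : 0 < CP) (hlam : 1 ≤ lam) :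
    ∃ C : ℝ≥0, 1 ≤ C ∧
      ∀ (X : Type*) [MetricSpace X] [CompleteSpace X] [MeasurableSpace X] [BorelSpace X]
        (μ : Measure X), IsDoublingWith μ CD → AMPoincareWith μ CP lam →
        {u : X → ℝ | MemBVAM μ u} = {u : X → ℝ | Integrable u μ ∧ MemBV μ u} ∧
        ∀ u : X → ℝ, Integrable u μ →
          (totalVarAM μ u ≤ C * totalVar μ u ∧ totalVar μ u ≤ C * totalVarAM μ u) ∧
          (normBVAM μ u ≤ C * normBV μ u ∧ normBV μ u ≤ C * normBVAM μ u) := by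
  obtain ⟨C, hC, h⟩ := proposition3p3_general CD CP lam hlam
  exact ⟨C, hC, fun X _ _ _ _ μ hD hP =>
    (h X μ hD hP).imp_right fun hu u hint => hu u fun _ _ => hint.integrableOn⟩
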